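/- For a finite simple graph $G$, let $\rho(G)$ denote its spectral radius, i.e. the largest eigenvalue of its adjacency matrix, and for a connected graph $G$ let $G^2$ denote its square: the graph on the same vertices in which two distinct vertices are adjacent if and only if their distance in $G$ is at most $2$. Let $P_n$ be the path of order $n$ (that is, on $n$ vertices). Then for every $n \ge 4$ and every tree $T$ of order $n$, $$\rho(T^2) \ge \rho(P_n^2),$$ with equality if and only if $T$ is isomorphic to $P_n$. -/

import Mathlib

/-- The square of a graph `G`: two distinct vertices are adjacent when their distance in `G` is at
most `2`. The distance is the extended one, so vertices in different components are at distance
`⊤` and stay non-adjacent. -/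
def graphSquare {V : Type*} (G : SimpleGraph V) : SimpleGraph V where
  Adj u v := u ≠ v ∧ G.edist u v ≤ 2
  symm := ⟨fun u v h => ⟨h.1.symm, by rw [SimpleGraph.edist_comm]; exact h.2⟩⟩
  loopless := ⟨fun _ h => h.1 rfl⟩

open Classical in
/-- The spectral radius of a finite graph `G`: the largest eigenvalue of its real adjacency matrix
(the eigenvalues of a square matrix are exactly the elements of its spectrum). -/
noncomputable def graphSpectralRadius {V : Type*} [Fintype V] (G : SimpleGraph V) : ℝ :=
  sSup (spectrum ℝ (G.adjMatrix ℝ))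

open Classical in
/-- On a nonempty vertex set the supremum above is attained, so it is a largest eigenvalue. -/
theorem graphSpectralRadius_isGreatest {V : Type*} [Fintype V] [Nonempty V] (G : SimpleGraph V) :
    IsGreatest (spectrum ℝ (G.adjMatrix ℝ)) (graphSpectralRadius G) := by
  have hA : (G.adjMatrix ℝ).IsHermitian := by
    rw [Matrix.IsHermitian, Matrix.conjTranspose_eq_transpose_of_trivial]
    exact SimpleGraph.transpose_adjMatrix G
  have hs : spectrum ℝ (G.adjMatrix ℝ) = Set.range hA.eigenvalues :=
    hA.spectrum_real_eq_range_eigenvalues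
  have hfin : (spectrum ℝ (G.adjMatrix ℝ)).Finite := by
    rw [hs]; exact Set.finite_range _
  have hne : (spectrum ℝ (G.adjMatrix ℝ)).Nonempty := by
    rw [hs]; exact Set.range_nonempty _
  exact ⟨hne.csSup_mem hfin, fun _ hx => le_csSup hfin.bddAbove hx⟩

open Matrix Finset

/-! Label the path from its centre outwards, as in … 5 3 1 0 2 4 …. In the square, each label j ≥ 2
then has exactly two smaller neighbours, `max 1 (j - 2)` and `j - 4` with truncated subtraction, and
the Perron vector x decreases with the label (`exists_pos_antitone_perron`).

The vertices of any connected graph on at least two vertices can be ordered by distance from a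
vertex of minimal eccentricity so that, in the square, each j ≥ 2 has two smaller neighbours with
labels at most those two (`exists_equiv_dominatesCenterOut`). As x is decreasing, the quadratic form
of that square at x is at least that of the path, and the Rayleigh bound `adjForm_le` gives the
inequality.

A vertex of degree at least three spans a K₄ with three of its neighbours in the square. The last
vertex of this K₄ has a third smaller neighbour, and x > 0 makes the inequality strict. A tree
without such a vertex is a path. -/

/-! ### Squares of graphs and isomorphism invariance -/

theorem graphSquare_adj {V : Type*} {G : SimpleGraph V} {u v : V} :
    (graphSquare G).Adj u v ↔ u ≠ v ∧ (G.Adj u v ∨ ∃ w, G.Adj u w ∧ G.Adj w v) := by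
  refine and_congr_right fun huv => ⟨fun h => ?_, fun h => ?_⟩
  · obtain ⟨p, hp⟩ := SimpleGraph.exists_walk_of_edist_ne_top
      (ne_top_of_le_ne_top (by decide) h : G.edist u v ≠ ⊤)
    rw [← hp] at h
    have hl : p.length ≤ 2 := by exact_mod_cast h
    match p, hl with
    | .nil, _ => exact absurd rfl huv
    | .cons h1 .nil, _ => exact Or.inl h1
    | .cons h1 (.cons h2 .nil), _ => exact Or.inr ⟨_, h1, h2⟩
    | .cons _ (.cons _ (.cons _ q)), hl =>
      simp only [SimpleGraph.Walk.length_cons] at hl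
      omega
  · rcases h with h | ⟨w, h1, h2⟩
    · exact (SimpleGraph.edist_le h.toWalk).trans (by simp)
    · exact (SimpleGraph.edist_le (.cons h1 (.cons h2 .nil))).trans (by simp)

/-- An isomorphism of graphs is an isomorphism of their squares. -/
def graphSquareIso {V W : Type*} {G : SimpleGraph V} {H : SimpleGraph W} (e : G ≃g H) :
    graphSquare G ≃g graphSquare H where
  toEquiv := e.toEquiv
  map_rel_iff' := by
    intro a b
    simp only [graphSquare_adj, ← e.map_adj_iff (v := a), RelIso.coe_fn_toEquiv, ne_eq,
      EmbeddingLike.apply_eq_iff_eq]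
    refine and_congr_right fun _ => or_congr_right ⟨?_, ?_⟩
    · rintro ⟨w, h1, h2⟩
      exact ⟨e.symm w, by simpa using h1, by rw [← e.map_adj_iff]; simpa using h2⟩
    · rintro ⟨w, h1, h2⟩
      exact ⟨e w, h1, e.map_adj_iff.2 h2⟩

theorem graphSpectralRadius_congr {V W : Type*} [Fintype V] [Fintype W] {G : SimpleGraph V}
    {H : SimpleGraph W} (e : G ≃g H) : graphSpectralRadius G = graphSpectralRadius H := by
  classical
  unfold graphSpectralRadius
  rw [← AlgEquiv.spectrum_eq (Matrix.reindexAlgEquiv ℝ ℝ e.toEquiv)]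
  congr 2
  ext i j
  simp only [coe_reindexAlgEquiv, reindex_apply, submatrix_apply, SimpleGraph.adjMatrix_apply]
  congr 1
  exact propext (e.symm.map_adj_iff)

/-! ### Rayleigh and Perron bounds -/

open Classical in
/-- The quadratic form of the adjacency matrix. -/
noncomputable def adjForm {V : Type*} [Fintype V] (G : SimpleGraph V) (x : V → ℝ) : ℝ :=
  ∑ i, ∑ j, if G.Adj i j then x i * x j else 0

theorem adjForm_le {V : Type*} [Fintype V] [Nonempty V] (G : SimpleGraph V) (x : V → ℝ) :
    adjForm G x ≤ graphSpectralRadius G * ∑ i, x i ^ 2 := by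
  classical
  set r := graphSpectralRadius G
  have hps : (algebraMap ℝ (Matrix V V ℝ) r - G.adjMatrix ℝ).PosSemidef := by
    rw [Matrix.posSemidef_iff_isHermitian_and_spectrum_nonneg]
    refine ⟨?_, ?_⟩
    · rw [Matrix.IsHermitian, conjTranspose_eq_transpose_of_trivial, transpose_sub,
        SimpleGraph.transpose_adjMatrix, Matrix.algebraMap_eq_diagonal, diagonal_transpose]
    · rw [← spectrum.singleton_sub_eq]
      rintro _ ⟨a, rfl, b, hb, rfl⟩
      have h := (graphSpectralRadius_isGreatest G).2 (by convert hb)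
      exact sub_nonneg.2 h
  have h := hps.dotProduct_mulVec_nonneg x
  rw [sub_mulVec, dotProduct_sub, sub_nonneg] at h
  calc adjForm G x = star x ⬝ᵥ (G.adjMatrix ℝ *ᵥ x) := by
        simp only [adjForm, dotProduct, mulVec, star_trivial, mul_sum]
        refine sum_congr rfl fun i _ => sum_congr rfl fun j _ => ?_
        simp [SimpleGraph.adjMatrix_apply]
    _ ≤ _ := h
    _ = _ := by
        rw [Algebra.algebraMap_eq_smul_one, smul_mulVec, one_mulVec]
        simp only [dotProduct, Pi.smul_apply, star_trivial, smul_eq_mul, mul_sum]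
        exact sum_congr rfl fun i _ => by ring

/-- The eigenvalue of a positive eigenvector of the adjacency matrix bounds the spectral radius. -/
theorem graphSpectralRadius_le_of_pos_eigenvector {V : Type*} [Fintype V] [Nonempty V]
    (G : SimpleGraph V) (x : V → ℝ) (hx : ∀ i, 0 < x i) (a : ℝ)
    (h : ∀ i, (open Classical in ∑ j, if G.Adj i j then x j else 0) = a * x i) :
    graphSpectralRadius G ≤ a := by
  classical
  set r := graphSpectralRadius G
  have hr := (graphSpectralRadius_isGreatest G).1
  have hr' : r ∈ spectrum ℝ (G.adjMatrix ℝ).toLin' := by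
    rw [Matrix.spectrum_toLin']; convert hr
  obtain ⟨z, hz⟩ := (Module.End.hasEigenvalue_iff_mem_spectrum.2 hr').exists_hasEigenvector
  have hz0 : z ≠ 0 := hz.2
  have hzi : ∀ i, ∑ j, (if G.Adj i j then z j else 0) = r * z i := by
    intro i
    have := congrFun hz.apply_eq_smul i
    simpa [Matrix.toLin'_apply, mulVec, dotProduct, SimpleGraph.adjMatrix_apply] using this
  have hle : ∀ i, r * |z i| ≤ ∑ j, (if G.Adj i j then |z j| else 0) := by
    intro i
    calc r * |z i| ≤ |r| * |z i| := by gcongr; exact le_abs_self r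
      _ = |∑ j, (if G.Adj i j then z j else 0)| := by rw [hzi, abs_mul]
      _ ≤ ∑ j, |if G.Adj i j then z j else 0| := abs_sum_le_sum_abs _ _
      _ = _ := sum_congr rfl fun j _ => by split_ifs <;> simp
  -- Pair r|z| ≤ A|z| with x and move A onto x by symmetry.
  have key : r * ∑ i, x i * |z i| ≤ a * ∑ i, x i * |z i| := by
    calc r * ∑ i, x i * |z i| = ∑ i, x i * (r * |z i|) := by
          rw [mul_sum]; exact sum_congr rfl fun i _ => by ring
      _ ≤ ∑ i, x i * ∑ j, (if G.Adj i j then |z j| else 0) :=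
          sum_le_sum fun i _ => mul_le_mul_of_nonneg_left (hle i) (hx i).le
      _ = ∑ j, |z j| * ∑ i, (if G.Adj j i then x i else 0) := by
          simp only [mul_sum]
          rw [sum_comm]
          refine sum_congr rfl fun j _ => sum_congr rfl fun i _ => ?_
          simp only [G.adj_comm i j]
          split_ifs <;> ring
      _ = _ := by
          rw [mul_sum]
          refine sum_congr rfl fun i _ => ?_
          have := h i
          rw [show (∑ j, if G.Adj i j then x j else 0) = a * x i by convert this]
          ring
  obtain ⟨i, hi⟩ := Function.ne_iff.1 hz0
  have hpos : 0 < ∑ i, x i * |z i| :=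
    sum_pos' (fun i _ => mul_nonneg (hx i).le (abs_nonneg _))
      ⟨i, mem_univ _, mul_pos (hx i) (abs_pos.2 hi)⟩
  exact le_of_mul_le_mul_right key hpos

/-! ### The path labelled from its centre -/

/-- The square of the path on `Fin n` whose vertices are labelled from the centre outwards, so that
the edges of the path are `{0, 1}` and `{i, i + 2}`. The five labels in the definition enumerate in
increasing order the closed neighbourhood of `i` in the square of the infinite path. -/
def centerOutSquare (n : ℕ) : SimpleGraph (Fin n) where
  Adj i j := i ≠ j ∧ ((j : ℕ) = i - 4 ∨ (j : ℕ) = max 1 ((i : ℕ) - 2) ∨ (j : ℕ) = max 2 (i : ℕ) ∨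
    (j : ℕ) = max 3 ((i : ℕ) + 2) ∨ (j : ℕ) = i + 4)
  symm := ⟨fun i j h => ⟨h.1.symm, by have := h.2; omega⟩⟩
  loopless := ⟨fun _ h => h.1 rfl⟩

theorem graphSquare_pathGraph_adj {n : ℕ} {u v : Fin n} :
    (graphSquare (SimpleGraph.pathGraph n)).Adj u v ↔
      u ≠ v ∧ (u : ℕ) ≤ v + 2 ∧ (v : ℕ) ≤ u + 2 := by
  rw [graphSquare_adj]
  refine and_congr_right fun huv => ?_
  have huv' : (u : ℕ) ≠ v := fun h => huv (Fin.ext h)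
  simp only [SimpleGraph.pathGraph_adj]
  constructor
  · rintro (h | ⟨w, h1, h2⟩) <;> omega
  · intro h
    by_cases h1 : (u : ℕ) + 1 = v ∨ (v : ℕ) + 1 = u
    · exact Or.inl h1
    · rcases lt_or_gt_of_ne huv' with h2 | h2
      · exact Or.inr ⟨⟨u + 1, by omega⟩, by simp, by simp; omega⟩
      · exact Or.inr ⟨⟨v + 1, by omega⟩, by simp; omega, by simp⟩

/-- The position on the path of the vertex with a given label. -/
def centerOutPosition (n : ℕ) (r : Fin n) : Fin n :=
  ⟨if (r : ℕ) % 2 = 0 then n / 2 + r / 2 else n / 2 - (r + 1) / 2, by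
    have := r.2
    split_ifs <;> omega⟩

theorem centerOutPosition_injective (n : ℕ) : Function.Injective (centerOutPosition n) := by
  intro a b h
  have ha := a.2
  have hb := b.2
  simp only [centerOutPosition, Fin.mk.injEq] at h
  apply Fin.ext
  split_ifs at h <;> omega

/-- The square of the path is the square of the path labelled from the centre outwards. -/
noncomputable def centerOutSquareIso (n : ℕ) :
    centerOutSquare n ≃g graphSquare (SimpleGraph.pathGraph n) where
  toEquiv := Equiv.ofBijective (centerOutPosition n)
    (Finite.injective_iff_bijective.1 (centerOutPosition_injective n))
  map_rel_iff' := by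
    intro a b
    rw [graphSquare_pathGraph_adj]
    simp only [Equiv.ofBijective_apply, (centerOutPosition_injective n).ne_iff, centerOutSquare]
    refine and_congr_right fun hab => ?_
    have hab' : (a : ℕ) ≠ b := fun h => hab (Fin.ext h)
    have ha := a.2
    have hb := b.2
    simp only [centerOutPosition]
    split_ifs <;> omega

/-! ### The operator I + A on decreasing vectors -/

/-- Extension of a vector by zero. -/
def extendZero {n : ℕ} (x : Fin n → ℝ) (k : ℕ) : ℝ := if h : k < n then x ⟨k, h⟩ else 0

theorem extendZero_eq_sum {n : ℕ} (x : Fin n → ℝ) (k : ℕ) :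
    extendZero x k = ∑ j : Fin n, if (j : ℕ) = k then x j else 0 := by
  unfold extendZero
  split_ifs with h
  · rw [sum_eq_single (⟨k, h⟩ : Fin n)]
    · simp
    · intro b _ hb
      rw [if_neg fun h' => hb (Fin.ext h')]
    · simp
  · exact (sum_eq_zero fun j _ => if_neg (by have := j.2; omega)).symm

theorem extendZero_antitone {n : ℕ} {x : Fin n → ℝ} (hx : Antitone x) (h0 : ∀ i, 0 ≤ x i) :
    Antitone (extendZero x) := by
  intro a b hab
  unfold extendZero
  split_ifs with h1 h2 h2
  · exact hx hab
  · omega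
  · exact h0 _
  · exact le_rfl

theorem extendZero_nonneg {n : ℕ} {x : Fin n → ℝ} (h0 : ∀ i, 0 ≤ x i) (k : ℕ) :
    0 ≤ extendZero x k := by
  unfold extendZero
  split_ifs
  · exact h0 _
  · exact le_rfl

theorem extendZero_val {n : ℕ} (x : Fin n → ℝ) (i : Fin n) : extendZero x i = x i := by
  simp [extendZero]

/-- The sum of a vector over the closed neighbourhoods of `centerOutSquare n`. -/
def windowSum {n : ℕ} (x : Fin n → ℝ) (i : Fin n) : ℝ :=
  extendZero x (i - 4) + extendZero x (max 1 ((i : ℕ) - 2)) + extendZero x (max 2 (i : ℕ)) +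
    extendZero x (max 3 ((i : ℕ) + 2)) + extendZero x (i + 4)

open Classical in
theorem windowSum_eq {n : ℕ} (x : Fin n → ℝ) (i : Fin n) :
    windowSum x i = x i + ∑ j, if (centerOutSquare n).Adj i j then x j else 0 := by
  rw [← extendZero_val x i]
  simp only [windowSum, extendZero_eq_sum, ← sum_add_distrib]
  refine sum_congr rfl fun j _ => ?_
  have h : (centerOutSquare n).Adj i j ↔ (i : ℕ) ≠ j ∧ ((j : ℕ) = i - 4 ∨
      (j : ℕ) = max 1 ((i : ℕ) - 2) ∨ (j : ℕ) = max 2 (i : ℕ) ∨ (j : ℕ) = max 3 ((i : ℕ) + 2) ∨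
      (j : ℕ) = i + 4) := by
    simp [centerOutSquare, Fin.ext_iff]
  simp only [h]
  generalize (i : ℕ) = a
  generalize hb : (j : ℕ) = b
  -- The five labels are distinct and one of them is `a` itself, so at most one indicator on the
  -- left is nonzero.
  by_cases h0 : b = a - 4
  · have h1 : b ≠ max 1 (a - 2) := by omega
    have h2 : b ≠ max 2 a := by omega
    have h3 : b ≠ max 3 (a + 2) := by omega
    have h4 : b ≠ a + 4 := by omega
    rw [if_pos h0, if_neg h1, if_neg h2, if_neg h3, if_neg h4]
    split_ifs <;> first | (exfalso; omega) | simp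
  by_cases h1 : b = max 1 (a - 2)
  · have h2 : b ≠ max 2 a := by omega
    have h3 : b ≠ max 3 (a + 2) := by omega
    have h4 : b ≠ a + 4 := by omega
    rw [if_neg h0, if_pos h1, if_neg h2, if_neg h3, if_neg h4]
    split_ifs <;> first | (exfalso; omega) | simp
  by_cases h2 : b = max 2 a
  · have h3 : b ≠ max 3 (a + 2) := by omega
    have h4 : b ≠ a + 4 := by omega
    rw [if_neg h0, if_neg h1, if_pos h2, if_neg h3, if_neg h4]
    split_ifs <;> first | (exfalso; omega) | simp
  by_cases h3 : b = max 3 (a + 2)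
  · have h4 : b ≠ a + 4 := by omega
    rw [if_neg h0, if_neg h1, if_neg h2, if_pos h3, if_neg h4]
    split_ifs <;> first | (exfalso; omega) | simp
  rw [if_neg h0, if_neg h1, if_neg h2, if_neg h3]
  split_ifs <;> first | (exfalso; omega) | simp

/-- Each of the five labels, listed in increasing order, is a nondecreasing function of the centre
`i`. This is why closed neighbourhoods, hence I + A in place of A, are used. -/
theorem windowSum_antitone {n : ℕ} {x : Fin n → ℝ} (hx : Antitone x) (h0 : ∀ i, 0 ≤ x i) :
    Antitone (windowSum x) := by
  intro a b hab
  have hX := extendZero_antitone hx h0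
  have hab' : (a : ℕ) ≤ b := hab
  unfold windowSum
  gcongr <;> apply hX <;> omega

theorem windowSum_nonneg {n : ℕ} {x : Fin n → ℝ} (h0 : ∀ i, 0 ≤ x i) (i : Fin n) :
    0 ≤ windowSum x i := by
  have := extendZero_nonneg h0
  unfold windowSum
  linarith [this (i - 4), this (max 1 ((i : ℕ) - 2)), this (max 2 (i : ℕ)), this (max 3 ((i : ℕ) + 2)), this (i + 4)]

theorem sum_mul_windowSum {n : ℕ} (x : Fin n → ℝ) :
    ∑ i, x i * windowSum x i = ∑ i, x i ^ 2 + adjForm (centerOutSquare n) x := by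
  classical
  simp only [windowSum_eq, adjForm, mul_add, sum_add_distrib, mul_sum, mul_ite, mul_zero]
  congr 1
  exact sum_congr rfl fun i _ => by ring

theorem extendZero_add_smul {n : ℕ} (x y : Fin n → ℝ) (t : ℝ) (k : ℕ) :
    extendZero (x + t • y) k = extendZero x k + t * extendZero y k := by
  unfold extendZero
  split_ifs <;> simp

theorem windowSum_add_smul {n : ℕ} (x y : Fin n → ℝ) (t : ℝ) (i : Fin n) :
    windowSum (x + t • y) i = windowSum x i + t * windowSum y i := by
  simp only [windowSum, extendZero_add_smul]
  ring

theorem sum_mul_windowSum_comm {n : ℕ} (x y : Fin n → ℝ) :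
    ∑ i, x i * windowSum y i = ∑ i, y i * windowSum x i := by
  classical
  simp only [windowSum_eq, mul_add, sum_add_distrib, mul_sum]
  congr 1
  · exact sum_congr rfl fun i _ => mul_comm _ _
  · rw [sum_comm]
    refine sum_congr rfl fun i _ => sum_congr rfl fun j _ => ?_
    simp only [(centerOutSquare n).adj_comm i j]
    split_ifs <;> ring

/-! ### A decreasing Perron vector -/

theorem isCompact_antitone_unit (n : ℕ) :
    IsCompact {x : Fin n → ℝ | Antitone x ∧ (∀ i, 0 ≤ x i) ∧ ∑ i, x i ^ 2 = 1} := by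
  refine (isCompact_Icc (a := (0 : Fin n → ℝ)) (b := 1)).of_isClosed_subset ?_ ?_
  · simp only [Antitone, Set.ofPred_and, Set.ofPred_forall]
    refine IsClosed.inter ?_ (IsClosed.inter ?_ ?_)
    · exact isClosed_iInter fun i => isClosed_iInter fun j => isClosed_iInter fun _ =>
        isClosed_le (continuous_apply j) (continuous_apply i)
    · exact isClosed_iInter fun i => isClosed_le continuous_const (continuous_apply i)
    · exact isClosed_eq (by fun_prop) continuous_const
  · rintro x ⟨-, h0, h1⟩
    refine ⟨fun i => h0 i, fun i => ?_⟩
    have : x i ^ 2 ≤ 1 := h1 ▸ single_le_sum (f := fun i => x i ^ 2) (fun _ _ => sq_nonneg _)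
      (mem_univ i)
    exact (abs_le_one_iff_mul_self_le_one.2 (by nlinarith)).trans' (le_abs_self _)

/-- The square of the path has an eigenvector that decreases from the centre outwards. -/
theorem exists_antitone_windowSum_eigenvector (n : ℕ) (hn : 0 < n) :
    ∃ (x : Fin n → ℝ) (a : ℝ), Antitone x ∧ (∀ i, 0 ≤ x i) ∧ ∑ i, x i ^ 2 = 1 ∧
      ∀ i, windowSum x i = a * x i := by
  set q : (Fin n → ℝ) → ℝ := fun x => ∑ i, x i * windowSum x i with hq
  have hcont : Continuous q := by
    simp only [hq, sum_mul_windowSum, adjForm]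
    refine Continuous.add (by fun_prop) (continuous_finsetSum _ fun i _ =>
      continuous_finsetSum _ fun j _ => ?_)
    split_ifs <;> fun_prop
  -- Maximise the form of I + A over unit vectors of the cone of decreasing nonnegative vectors. I +
  -- A preserves this cone, which makes the constrained maximiser a genuine eigenvector.
  obtain ⟨x, ⟨hx, hx0, hx1⟩, hmax⟩ := (isCompact_antitone_unit n).exists_isMaxOn
    ⟨fun i => if (i : ℕ) = 0 then 1 else 0, by
      refine ⟨fun i j hij => ?_, fun i => ?_, ?_⟩
      · have : (i : ℕ) ≤ j := hij
        dsimp only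
        split_ifs <;> first | omega | norm_num
      · dsimp only
        split_ifs <;> norm_num
      · rw [sum_eq_single (⟨0, hn⟩ : Fin n)]
        · simp
        · intro b _ hb
          dsimp only
          rw [if_neg fun h : (b : ℕ) = 0 => hb (Fin.ext h)]
          norm_num
        · simp⟩ hcont.continuousOn
  set a := q x
  have hbound : ∀ y : Fin n → ℝ, Antitone y → (∀ i, 0 ≤ y i) → q y ≤ a * ∑ i, y i ^ 2 := by
    intro y hy hy0
    set s := ∑ i, y i ^ 2
    rcases (sum_nonneg fun i _ => sq_nonneg (y i) : 0 ≤ s).eq_or_lt with h | h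
    · have hz : ∀ i, y i = 0 := fun i =>
        pow_eq_zero_iff two_ne_zero |>.1
          ((sum_eq_zero_iff_of_nonneg fun i _ => sq_nonneg (y i)).1 h.symm i (mem_univ i))
      rw [show s = 0 from h.symm]
      simp [hq, hz]
    · have hr : 0 < Real.sqrt s := Real.sqrt_pos.2 h
      set t := (Real.sqrt s)⁻¹ with ht
      have ht0 : 0 < t := inv_pos.2 hr
      have hts : t ^ 2 * s = 1 := by
        rw [ht, inv_pow, Real.sq_sqrt h.le, inv_mul_cancel₀ h.ne']
      have hw : ∀ i, windowSum (t • y) i = t * windowSum y i := by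
        intro i
        have := windowSum_add_smul 0 y t i
        simpa [windowSum, extendZero] using this
      have hle : q (t • y) ≤ a := hmax ⟨fun i j hij => mul_le_mul_of_nonneg_left (hy hij) ht0.le,
        fun i => mul_nonneg ht0.le (hy0 i), by
          simp only [Pi.smul_apply, smul_eq_mul, mul_pow, ← mul_sum]; exact hts⟩
      have hqt : q (t • y) = t ^ 2 * q y := by
        simp only [hq, hw, Pi.smul_apply, smul_eq_mul, mul_sum]
        exact sum_congr rfl fun i _ => by ring
      calc q y = (t ^ 2 * q y) * s := by rw [mul_right_comm, hts, one_mul]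
        _ ≤ a * s := mul_le_mul_of_nonneg_right (hqt ▸ hle) h.le
  set w := windowSum x with hw
  have hwanti : Antitone w := windowSum_antitone hx hx0
  have hw0 : ∀ i, 0 ≤ w i := windowSum_nonneg hx0
  set m := ∑ i, w i ^ 2 with hm
  have hxw : ∑ i, x i * w i = a := rfl
  -- The vector x + t w stays in the cone, so `hbound` applies to it; the constant terms cancel and
  -- a factor t is removed.
  have hineq : ∀ t : ℝ, 0 < t → 2 * (m - a ^ 2) ≤ t * (a * m - q w) := by
    intro t ht
    have h := hbound (x + t • w) (fun i j hij => add_le_add (hx hij)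
      (mul_le_mul_of_nonneg_left (hwanti hij) ht.le))
      (fun i => add_nonneg (hx0 i) (mul_nonneg ht.le (hw0 i)))
    have h1 : q (x + t • w) = a + 2 * t * m + t ^ 2 * q w := by
      have hc := sum_mul_windowSum_comm x w
      have hc' : ∑ i, w i * windowSum x i = m := sum_congr rfl fun i _ => by rw [sq, hw]
      calc q (x + t • w) = ∑ i, x i * windowSum x i + t * (∑ i, x i * windowSum w i)
            + t * (∑ i, w i * windowSum x i) + t ^ 2 * ∑ i, w i * windowSum w i := by
            simp only [hq, windowSum_add_smul, mul_sum, ← sum_add_distrib, Pi.add_apply,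
              Pi.smul_apply, smul_eq_mul]
            exact sum_congr rfl fun i _ => by ring
        _ = a + t * m + t * m + t ^ 2 * q w := by rw [hc, hc']
        _ = _ := by ring
    have h2 : ∑ i, (x + t • w) i ^ 2 = 1 + 2 * t * a + t ^ 2 * m := by
      rw [← hx1, ← hxw, hm]
      simp only [mul_sum, ← sum_add_distrib, Pi.add_apply, Pi.smul_apply, smul_eq_mul]
      exact sum_congr rfl fun i _ => by ring
    rw [h1, h2] at h
    refine le_of_mul_le_mul_left ?_ ht
    nlinarith
  -- This is the limit t → 0, made explicit by a t for which the right side of `hineq` is at most m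
  -- - a².
  have hma : m - a ^ 2 ≤ 0 := by
    by_contra! hpos
    set c := a * m - q w
    have h1 := hineq ((m - a ^ 2) / (|c| + 1)) (by positivity)
    have h2 : (m - a ^ 2) / (|c| + 1) * c ≤ m - a ^ 2 := by
      rw [div_mul_eq_mul_div, div_le_iff₀ (by positivity)]
      exact mul_le_mul_of_nonneg_left ((le_abs_self c).trans (by linarith)) hpos.le
    linarith
  -- Equality case of Cauchy–Schwarz: |x| = 1, ⟨x, w⟩ = a and |w|² ≤ a² force w = a x.
  have hsq : ∑ i, (w i - a * x i) ^ 2 = m - a ^ 2 := by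
    calc ∑ i, (w i - a * x i) ^ 2
        = m - 2 * a * (∑ i, x i * w i) + a ^ 2 * ∑ i, x i ^ 2 := by
          simp only [hm, mul_sum, ← sum_add_distrib, ← sum_sub_distrib]
          exact sum_congr rfl fun i _ => by ring
      _ = _ := by rw [hxw, hx1]; ring
  refine ⟨x, a, hx, hx0, hx1, fun i => ?_⟩
  have h0 := (sum_eq_zero_iff_of_nonneg fun i _ => sq_nonneg (w i - a * x i)).1
    (le_antisymm (hsq ▸ hma) (sum_nonneg fun i _ => sq_nonneg _)) i (mem_univ i)
  exact sub_eq_zero.1 (pow_eq_zero_iff two_ne_zero |>.1 h0)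

/-- The Perron vector of the square of the path decreases from the centre outwards. -/
theorem exists_pos_antitone_perron (n : ℕ) (hn : 0 < n) :
    ∃ x : Fin n → ℝ, Antitone x ∧ (∀ i, 0 < x i) ∧
      graphSpectralRadius (centerOutSquare n) * ∑ i, x i ^ 2 ≤ adjForm (centerOutSquare n) x := by
  classical
  obtain ⟨x, a, hx, hx0, hx1, he⟩ := exists_antitone_windowSum_eigenvector n hn
  have hX := extendZero_nonneg hx0
  -- The largest entry x₀ cannot vanish. For k > 0, a zero at k would make its window sum zero, but
  -- that sum contains the entry at the truncated `k - 4`, positive by induction.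
  have hpos : ∀ (k : ℕ) (hk : k < n), 0 < x ⟨k, hk⟩ := by
    intro k
    induction k using Nat.strong_induction_on with
    | _ k ih =>
      intro hk
      refine (hx0 _).lt_of_ne fun h0 => ?_
      rcases Nat.eq_zero_or_pos k with rfl | hk0
      · have hz : ∀ i, x i = 0 := fun i =>
          le_antisymm ((hx (show (⟨0, hk⟩ : Fin n) ≤ i from Nat.zero_le _)).trans h0.symm.le) (hx0 i)
        simp [hz] at hx1
      · have h := he ⟨k, hk⟩
        rw [← h0, mul_zero] at h
        have hlt := ih (k - 4) (by omega) (by omega)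
        have hX0 : extendZero x (k - 4) = x ⟨k - 4, by omega⟩ := extendZero_val x ⟨k - 4, by omega⟩
        simp only [windowSum] at h
        linarith [hX (max 1 (k - 2)), hX (max 2 k), hX (max 3 (k + 2)), hX (k + 4)]
  have : Nonempty (Fin n) := ⟨⟨0, hn⟩⟩
  refine ⟨x, hx, fun i => hpos i i.2, ?_⟩
  have hr : graphSpectralRadius (centerOutSquare n) ≤ a - 1 := by
    refine graphSpectralRadius_le_of_pos_eigenvector _ x (fun i => hpos i i.2) _ fun i => ?_
    have h1 := he i
    rw [windowSum_eq] at h1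
    linarith
  have hform : adjForm (centerOutSquare n) x = a - 1 := by
    have h := sum_mul_windowSum x
    have h2 : ∑ i, x i * windowSum x i = a := by
      calc ∑ i, x i * windowSum x i = a * ∑ i, x i ^ 2 := by
            rw [mul_sum]; exact sum_congr rfl fun i _ => by rw [he]; ring
        _ = a := by rw [hx1, mul_one]
    rw [h2, hx1] at h
    linarith
  rw [hform, hx1, mul_one]
  exact hr

/-! ### Comparison through smaller neighbours -/

open Classical in
/-- The neighbours of `j` that precede it. -/
noncomputable def lowerNeighbors {n : ℕ} (G : SimpleGraph (Fin n)) (j : Fin n) : Finset (Fin n) :=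
  {i | i < j ∧ G.Adj j i}

theorem mem_lowerNeighbors {n : ℕ} {G : SimpleGraph (Fin n)} {i j : Fin n} :
    i ∈ lowerNeighbors G j ↔ i < j ∧ G.Adj j i := by
  simp [lowerNeighbors]

theorem adjForm_eq_sum_lowerNeighbors {n : ℕ} (G : SimpleGraph (Fin n)) (x : Fin n → ℝ) :
    adjForm G x = 2 * ∑ j, x j * ∑ i ∈ lowerNeighbors G j, x i := by
  classical
  have h1 : ∑ j, x j * ∑ i ∈ lowerNeighbors G j, x i =
      ∑ j, ∑ i, if i < j ∧ G.Adj j i then x j * x i else 0 := by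
    refine sum_congr rfl fun j _ => ?_
    rw [mul_sum, lowerNeighbors, sum_filter]
  have h2 : ∑ j, x j * ∑ i ∈ lowerNeighbors G j, x i =
      ∑ j, ∑ i, if j < i ∧ G.Adj j i then x j * x i else 0 := by
    rw [h1, sum_comm]
    refine sum_congr rfl fun j _ => sum_congr rfl fun i _ => ?_
    simp only [G.adj_comm i j]
    split_ifs <;> ring
  rw [two_mul]
  nth_rewrite 1 [h1]
  rw [h2, adjForm, ← sum_add_distrib]
  refine sum_congr rfl fun j _ => ?_
  rw [← sum_add_distrib]
  refine sum_congr rfl fun i _ => ?_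
  by_cases h : G.Adj j i
  · rcases lt_or_gt_of_ne h.ne with hlt | hlt <;> simp [h, hlt, hlt.le]
  · simp [h]

/-- Every vertex of `G` has at least as many, and at least as early, preceding neighbours as the
same vertex of `centerOutSquare n`. -/
structure DominatesCenterOut {n : ℕ} (G : SimpleGraph (Fin n)) : Prop where
  adj_zero : ∀ i j : Fin n, (i : ℕ) = 0 → (j : ℕ) = 1 → G.Adj j i
  exists_pair : ∀ j : Fin n, 2 ≤ (j : ℕ) → ∃ p ∈ lowerNeighbors G j, ∃ q ∈ lowerNeighbors G j,
    p ≠ q ∧ (p : ℕ) ≤ max 1 ((j : ℕ) - 2) ∧ (q : ℕ) ≤ (j : ℕ) - 4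

/-- Of the five labels in the closed neighbourhood of `j`, the last three are at least `j`. -/
theorem sum_lowerNeighbors_centerOutSquare_le {n : ℕ} {x : Fin n → ℝ} (hpos : ∀ i, 0 < x i)
    {j f g : Fin n} (hf : (f : ℕ) = max 1 ((j : ℕ) - 2)) (hg : (g : ℕ) = (j : ℕ) - 4) :
    ∑ i ∈ lowerNeighbors (centerOutSquare n) j, x i ≤ x f + x g := by
  have hfg : f ≠ g := fun h => by rw [h] at hf; omega
  rw [← sum_pair hfg]
  refine sum_le_sum_of_subset_of_nonneg (fun i hi => ?_) fun i _ _ => (hpos i).le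
  obtain ⟨hlt, -, h⟩ := mem_lowerNeighbors.1 hi
  have hlt' : (i : ℕ) < j := hlt
  rw [mem_insert, mem_singleton, Fin.ext_iff, Fin.ext_iff]
  omega

theorem DominatesCenterOut.sum_lowerNeighbors_le {n : ℕ} {G : SimpleGraph (Fin n)}
    (hG : DominatesCenterOut G) {x : Fin n → ℝ} (hx : Antitone x) (hpos : ∀ i, 0 < x i)
    (j : Fin n) :
    ∑ i ∈ lowerNeighbors (centerOutSquare n) j, x i ≤ ∑ i ∈ lowerNeighbors G j, x i := by
  have hjn := j.2
  rcases le_or_gt 2 (j : ℕ) with hj | hj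
  · obtain ⟨p, hp, q, hq, hpq, hp', hq'⟩ := hG.exists_pair j hj
    set f : Fin n := ⟨max 1 ((j : ℕ) - 2), by omega⟩
    set g : Fin n := ⟨(j : ℕ) - 4, by omega⟩
    calc _ ≤ x f + x g := sum_lowerNeighbors_centerOutSquare_le hpos rfl rfl
      _ ≤ x p + x q := add_le_add (hx hp') (hx hq')
      _ = ∑ i ∈ {p, q}, x i := (sum_pair hpq).symm
      _ ≤ _ := sum_le_sum_of_subset_of_nonneg (by simp [insert_subset_iff, hp, hq])
        fun i _ _ => (hpos i).le
  · refine sum_le_sum_of_subset_of_nonneg (fun i hi => ?_) fun i _ _ => (hpos i).le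
    have h : i < j := (mem_lowerNeighbors.1 hi).1
    have h' : (i : ℕ) < j := h
    exact mem_lowerNeighbors.2 ⟨h, hG.adj_zero i j (by omega) (by omega)⟩

theorem DominatesCenterOut.sum_lowerNeighbors_lt {n : ℕ} {G : SimpleGraph (Fin n)}
    (hG : DominatesCenterOut G) {x : Fin n → ℝ} (hx : Antitone x) (hpos : ∀ i, 0 < x i)
    {j : Fin n} (hcard : 2 < #(lowerNeighbors G j)) :
    ∑ i ∈ lowerNeighbors (centerOutSquare n) j, x i < ∑ i ∈ lowerNeighbors G j, x i := by
  have hjn := j.2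
  have hj : 2 ≤ (j : ℕ) := by
    have h : lowerNeighbors G j ⊆ Iio j := fun i hi => mem_Iio.2 (mem_lowerNeighbors.1 hi).1
    have := card_le_card h
    rw [Fin.card_Iio] at this
    omega
  obtain ⟨p, hp, q, hq, hpq, hp', hq'⟩ := hG.exists_pair j hj
  set f : Fin n := ⟨max 1 ((j : ℕ) - 2), by omega⟩
  set g : Fin n := ⟨(j : ℕ) - 4, by omega⟩
  have hsub : ({p, q} : Finset (Fin n)) ⊆ lowerNeighbors G j := by simp [insert_subset_iff, hp, hq]
  obtain ⟨r, hr, hr'⟩ := exists_mem_notMem_of_card_lt_card (s := {p, q}) (t := lowerNeighbors G j)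
    (by rwa [card_pair hpq])
  calc _ ≤ x f + x g := sum_lowerNeighbors_centerOutSquare_le hpos rfl rfl
    _ ≤ x p + x q := add_le_add (hx hp') (hx hq')
    _ = ∑ i ∈ {p, q}, x i := (sum_pair hpq).symm
    _ < _ := sum_lt_sum_of_subset hsub hr hr' (hpos r) fun i _ _ => (hpos i).le

theorem DominatesCenterOut.graphSpectralRadius_le {n : ℕ} (hn : 0 < n) {G : SimpleGraph (Fin n)}
    (hG : DominatesCenterOut G) :
    graphSpectralRadius (centerOutSquare n) ≤ graphSpectralRadius G ∧
      ((∃ j, 2 < #(lowerNeighbors G j)) →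
        graphSpectralRadius (centerOutSquare n) < graphSpectralRadius G) := by
  have : Nonempty (Fin n) := ⟨⟨0, hn⟩⟩
  obtain ⟨x, hx, hpos, hperron⟩ := exists_pos_antitone_perron n hn
  have hs : 0 < ∑ i, x i ^ 2 := sum_pos (fun i _ => pow_pos (hpos i) 2) univ_nonempty
  have hle : ∀ j ∈ univ, x j * ∑ i ∈ lowerNeighbors (centerOutSquare n) j, x i ≤
      x j * ∑ i ∈ lowerNeighbors G j, x i := fun j _ =>
    mul_le_mul_of_nonneg_left (hG.sum_lowerNeighbors_le hx hpos j) (hpos j).le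
  have hray := adjForm_le G x
  rw [adjForm_eq_sum_lowerNeighbors] at hperron hray
  refine ⟨le_of_mul_le_mul_right ?_ hs, fun ⟨j, hj⟩ => lt_of_mul_lt_mul_right ?_ hs.le⟩
  · linarith [sum_le_sum hle]
  · linarith [sum_lt_sum hle ⟨j, mem_univ j,
      mul_lt_mul_of_pos_left (hG.sum_lowerNeighbors_lt hx hpos hj) (hpos j)⟩]

/-! ### Ordering from a central vertex -/

theorem exists_dist_add_dist_eq {V : Type*} {G : SimpleGraph V} (hG : G.Connected) (c v : V)
    {k : ℕ} (hk : k ≤ G.dist c v) : ∃ w, G.dist c w = k ∧ k + G.dist w v = G.dist c v := by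
  obtain ⟨p, hp⟩ := hG.exists_walk_length_eq_dist c v
  refine ⟨p.getVert k, ?_⟩
  have h1 := SimpleGraph.dist_le (p.take k)
  have h2 := SimpleGraph.dist_le (p.drop k)
  rw [SimpleGraph.Walk.take_length] at h1
  rw [SimpleGraph.Walk.drop_length] at h2
  have h3 := hG.dist_triangle (u := c) (v := p.getVert k) (w := v)
  omega

/-- In a vertex of minimal eccentricity, no intermediate distance is attained only once. -/
theorem exists_center {V : Type*} [Finite V] {G : SimpleGraph V} (hG : G.Connected) :
    ∃ c l, (∀ v, G.dist c v ≤ G.dist c l) ∧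
      ∀ u, 1 ≤ G.dist c u → G.dist c u < G.dist c l → ∃ s, s ≠ u ∧ G.dist c s = G.dist c u := by
  have := hG.nonempty
  choose far hfar using fun c => Finite.exists_max (G.dist c)
  obtain ⟨c, hc⟩ := Finite.exists_min fun c => G.dist c (far c)
  refine ⟨c, far c, hfar c, fun u hu1 hu2 => ?_⟩
  by_contra! hcon
  -- If u were alone at its distance, the neighbour c' of c one step towards u would have smaller
  -- eccentricity: geodesics from c to vertices at least as far as u pass through u and get shorter,
  -- and nearer vertices end up at distance at most `G.dist c u`.
  obtain ⟨c', h1, h2⟩ := exists_dist_add_dist_eq hG c u hu1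
  set v := far c'
  have hD : G.dist c (far c) ≤ G.dist c' v := hc c'
  have hv := hfar c v
  rcases le_or_gt (G.dist c u) (G.dist c v) with h | h
  · obtain ⟨w, hw1, hw2⟩ := exists_dist_add_dist_eq hG c v h
    have hwu : w = u := by
      by_contra hne
      exact hcon w hne hw1
    subst hwu
    have := hG.dist_triangle (u := c') (v := w) (w := v)
    omega
  · have := hG.dist_triangle (u := c') (v := c) (w := v)
    rw [SimpleGraph.dist_comm (u := c') (v := c)] at this
    omega

theorem exists_equiv_monotone {V : Type*} [Fintype V] {n : ℕ} (hcard : Fintype.card V = n)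
    (key : V → ℕ) : ∃ e : Fin n ≃ V, Monotone (key ∘ e) := by
  let e₀ := Fintype.equivFinOfCardEq hcard
  exact ⟨(Tuple.sort (key ∘ e₀.symm)).trans e₀.symm, Tuple.monotone_sort (key ∘ e₀.symm)⟩

/-- The two early neighbours are the parent and grandparent in a breadth-first order, or the centre
and its first neighbour for vertices next to the centre. By `exists_center` every intermediate level
has at least two vertices, which supplies the gaps of 2 and 4 in the labels. -/
theorem exists_equiv_dominatesCenterOut {V : Type*} [Fintype V] {n : ℕ} (hn : 2 ≤ n)
    {G : SimpleGraph V} (hG : G.Connected) (hcard : Fintype.card V = n) :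
    ∃ e : Fin n ≃ V, DominatesCenterOut ((graphSquare G).comap e) := by
  classical
  obtain ⟨c, l, hl, hwide⟩ := exists_center hG
  obtain ⟨P, hP⟩ := hG.exists_walk_length_eq_dist c l
  set D := G.dist c l with hD
  have hPd : ∀ k ≤ D, G.dist c (P.getVert k) = k := by
    intro k hk
    have h1 := SimpleGraph.dist_le (P.take k)
    have h2 := SimpleGraph.dist_le (P.drop k)
    rw [SimpleGraph.Walk.take_length] at h1
    rw [SimpleGraph.Walk.drop_length] at h2
    have h3 := hG.dist_triangle (u := c) (v := P.getVert k) (w := l)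
    omega
  have hPadj : ∀ k < D, G.Adj (P.getVert k) (P.getVert (k + 1)) := fun k hk =>
    P.adj_getVert_succ (by omega)
  -- Sort by distance from c, with the vertex of the longest geodesic P first in each level.
  set key : V → ℕ := fun v => 2 * G.dist c v + if v = P.getVert (G.dist c v) then 0 else 1
    with hkey
  have hkey1 : ∀ v, 2 * G.dist c v ≤ key v := fun v => Nat.le_add_right _ _
  have hkey2 : ∀ v, key v ≤ 2 * G.dist c v + 1 := fun v => by
    simp only [hkey]; split_ifs <;> omega
  have hkeyP : ∀ k ≤ D, key (P.getVert k) = 2 * k := fun k hk => by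
    simp only [hkey, hPd k hk]; simp
  have hkeyN : ∀ v, v ≠ P.getVert (G.dist c v) → key v = 2 * G.dist c v + 1 := fun v hv => by
    simp only [hkey, if_neg hv]
  obtain ⟨e, he⟩ := exists_equiv_monotone hcard key
  have hlt : ∀ u v, key u < key v → (e.symm u : ℕ) < e.symm v := by
    intro u v h
    by_contra! hle
    have := he (show e.symm v ≤ e.symm u from hle)
    simp only [Function.comp_apply, Equiv.apply_symm_apply] at this
    omega
  have hne : ∀ u v, u ≠ v → (e.symm u : ℕ) ≠ e.symm v := fun u v h h' =>
    h (e.symm.injective (Fin.ext h'))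
  have hparent : ∀ v k, G.dist c v = k + 1 → ∃ p, G.dist c p = k ∧ G.Adj p v := by
    intro v k hv
    obtain ⟨p, hp1, hp2⟩ := exists_dist_add_dist_eq hG c v (k := k) (by omega)
    exact ⟨p, hp1, SimpleGraph.dist_eq_one_iff_adj.1 (by omega)⟩
  have hD1 : 1 ≤ D := by
    have : Nontrivial V := Fintype.one_lt_card_iff_nontrivial.1 (by omega)
    obtain ⟨v, hv⟩ := exists_ne c
    exact (hG.pos_dist_of_ne hv.symm).trans_le (hl v)
  have hc0 : (e.symm c : ℕ) = 0 := by
    have hz := he (show (⟨0, by omega⟩ : Fin n) ≤ e.symm c from Nat.zero_le _)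
    simp only [Function.comp_apply, Equiv.apply_symm_apply] at hz
    have h0 : key c = 0 := by simpa using hkeyP 0 (Nat.zero_le _)
    have h1 := hkey1 (e ⟨0, by omega⟩)
    have : c = e ⟨0, by omega⟩ := hG.dist_eq_zero_iff.1 (by omega)
    rw [this]
    simp
  have hone : ∀ u, (e.symm u : ℕ) = 1 → G.Adj c u := by
    intro u hu
    have h1 : (e.symm c : ℕ) < e.symm (P.getVert 1) := hlt _ _ (by
      rw [hkeyP 1 hD1]
      have := hkeyP 0 (Nat.zero_le _)
      rw [P.getVert_zero] at this
      omega)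
    have h2 := he (show e.symm u ≤ e.symm (P.getVert 1) from by rw [Fin.le_def]; omega)
    simp only [Function.comp_apply, Equiv.apply_symm_apply] at h2
    rw [hkeyP 1 hD1] at h2
    have h3 := hkey1 u
    have hcu : c ≠ u := fun h => by rw [← h] at hu; omega
    have h4 := hG.pos_dist_of_ne hcu
    exact SimpleGraph.dist_eq_one_iff_adj.1 (by omega)
  have hsq : ∀ (u : V) (j : Fin n), (e.symm u : ℕ) < j → (graphSquare G).Adj (e j) u →
      e.symm u ∈ lowerNeighbors ((graphSquare G).comap e) j := fun u j h h' =>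
    mem_lowerNeighbors.2 ⟨h, by simpa using h'⟩
  refine ⟨e, ⟨fun i j hi hj => ?_, fun j hj => ?_⟩⟩
  · have h : G.Adj c (e j) := hone _ (by simpa using hj)
    have hic : e i = c := by
      rw [← e.symm.injective.eq_iff, e.symm_apply_apply]
      exact Fin.ext (by omega)
    rw [SimpleGraph.comap_adj, hic]
    exact graphSquare_adj.2 ⟨h.ne', Or.inl h.symm⟩
  · obtain ⟨v, rfl⟩ := e.symm.surjective j
    have hvc : c ≠ v := fun h => by rw [← h] at hj; omega
    have hv1 := hG.pos_dist_of_ne hvc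
    suffices h : ∃ p q, p ≠ q ∧ (graphSquare G).Adj v p ∧ (graphSquare G).Adj v q ∧
        (e.symm p : ℕ) ≤ max 1 ((e.symm v : ℕ) - 2) ∧ (e.symm q : ℕ) ≤ (e.symm v : ℕ) - 4 by
      obtain ⟨p, q, hpq, hp, hq, hp', hq'⟩ := h
      refine ⟨e.symm p, hsq _ _ (by omega) (by simpa using hp), e.symm q,
        hsq _ _ (by omega) (by simpa using hq), fun h => hpq (e.symm.injective h), hp', hq'⟩
    rcases Nat.lt_or_ge (G.dist c v) 2 with hv2 | hv2
    · have hcv : G.Adj c v := SimpleGraph.dist_eq_one_iff_adj.1 (by omega)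
      set s := e ⟨1, by omega⟩ with hs
      have hs1 : (e.symm s : ℕ) = 1 := by simp [hs]
      have hcs := hone s hs1
      refine ⟨s, c, hcs.ne', graphSquare_adj.2 ⟨fun h => ?_, Or.inr ⟨c, hcv.symm, hcs⟩⟩,
        graphSquare_adj.2 ⟨hcv.ne', Or.inl hcv.symm⟩, by omega, by omega⟩
      rw [h] at hj
      omega
    · obtain ⟨k, hk⟩ : ∃ k, G.dist c v = k + 2 := ⟨G.dist c v - 2, by omega⟩
      have hkD : k + 2 ≤ D := hk ▸ hl v
      have hadj : ∀ p q, G.dist c p = k + 1 → G.dist c q = k → G.Adj q p → G.Adj p v →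
          p ≠ q ∧ (graphSquare G).Adj v p ∧ (graphSquare G).Adj v q := by
        intro p q hp hq h1 h2
        exact ⟨h1.ne', graphSquare_adj.2 ⟨h2.ne', Or.inl h2.symm⟩, graphSquare_adj.2
          ⟨fun h => by rw [h] at hk; omega, Or.inr ⟨p, h2.symm, h1.symm⟩⟩⟩
      have hother : ∀ u, 1 ≤ G.dist c u → G.dist c u ≤ k + 1 →
          ∃ s, s ≠ u ∧ G.dist c s = G.dist c u := fun u h1 h2 => hwide u h1 (by omega)
      -- On P, the order is P_k < t < P_{k+1} < s < v, with t and s further vertices of levels k and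
      -- k + 1; for k = 0 the label of P_0 = c is 0 and t is not needed.
      by_cases hvP : v = P.getVert (k + 2)
      · refine ⟨P.getVert (k + 1), P.getVert k, ?_⟩
        have hp := hPd (k + 1) (by omega)
        have hq := hPd k (by omega)
        obtain ⟨h1, h2, h3⟩ := hadj _ _ hp hq (hPadj k (by omega))
          (by rw [hvP]; exact hPadj (k + 1) (by omega))
        refine ⟨h1, h2, h3, ?_⟩
        have hkv : key v = 2 * (k + 2) := hvP ▸ hkeyP _ hkD
        have hkp := hkeyP (k + 1) (by omega)
        have hkq := hkeyP k (by omega)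
        obtain ⟨s, hs, hs'⟩ := hother (P.getVert (k + 1)) (by omega) (by omega)
        have hks : key s = 2 * (k + 1) + 1 := by
          rw [hkeyN s (by rwa [hs', hp]), hs', hp]
        have i1 := hlt (P.getVert (k + 1)) s (by omega)
        have i2 := hlt s v (by omega)
        refine ⟨by omega, ?_⟩
        rcases Nat.eq_zero_or_pos k with rfl | hk0
        · rw [P.getVert_zero, hc0]
          exact Nat.zero_le _
        · obtain ⟨t, ht, ht'⟩ := hother (P.getVert k) (by omega) (by omega)
          have hkt : key t = 2 * k + 1 := by
            rw [hkeyN t (by rwa [ht', hq]), ht', hq]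
          have i3 := hlt (P.getVert k) t (by omega)
          have i4 := hlt t (P.getVert (k + 1)) (by omega)
          omega
      -- Off P, the vertex P_{k+2} precedes v in its level. Thus p < P_{k+2} < v, and q lies below
      -- the four vertices p, s, P_{k+2}, v, with s a second vertex of level k + 1.
      · obtain ⟨p, hp, hpv⟩ := hparent v (k + 1) hk
        obtain ⟨q, hq, hqp⟩ := hparent p k hp
        obtain ⟨h1, h2, h3⟩ := hadj p q hp hq hqp hpv
        refine ⟨p, q, h1, h2, h3, ?_⟩
        have hkv : key v = 2 * (k + 2) + 1 := by rw [hkeyN v (by rwa [hk]), hk]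
        have hkL := hkeyP (k + 2) hkD
        have hkp := hkey2 p
        have hkp' := hkey1 p
        have hkq := hkey2 q
        have i1 := hlt p (P.getVert (k + 2)) (by omega)
        have i2 := hlt (P.getVert (k + 2)) v (by omega)
        refine ⟨by omega, ?_⟩
        obtain ⟨s, hs, hs'⟩ := hother p (by omega) (by omega)
        have hks := hkey2 s
        have hks' := hkey1 s
        have i3 := hlt s (P.getVert (k + 2)) (by omega)
        have i4 := hlt q p (by omega)
        have i5 := hlt q s (by omega)
        have i6 := hne s p hs
        omega

/-! ### The equality case -/

/-- The vertices w, a, b, c form a clique in the square, so the one with the largest label has the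
other three below it. -/
theorem exists_two_lt_card_lowerNeighbors {V : Type*} {n : ℕ} {G : SimpleGraph V} (e : Fin n ≃ V)
    {w a b c : V} (ha : G.Adj w a) (hb : G.Adj w b) (hc : G.Adj w c) (hab : a ≠ b) (hac : a ≠ c)
    (hbc : b ≠ c) : ∃ j, 2 < #(lowerNeighbors ((graphSquare G).comap e) j) := by
  classical
  set S : Finset V := {w, a, b, c} with hS
  have hcard : #S = 4 := by
    rw [hS, card_insert_of_notMem, card_insert_of_notMem, card_pair hbc]
    · simp [hab, hac]
    · simp [ha.ne, hb.ne, hc.ne]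
  have hw : ∀ u ∈ S, u = w ∨ G.Adj w u := by
    simp [hS, ha, hb, hc]
  have hclique : ∀ u ∈ S, ∀ v ∈ S, u ≠ v → (graphSquare G).Adj u v := by
    intro u hu v hv huv
    refine graphSquare_adj.2 ⟨huv, ?_⟩
    rcases hw u hu with rfl | h1
    · exact Or.inl ((hw v hv).resolve_left huv.symm)
    · rcases hw v hv with rfl | h2
      · exact Or.inl h1.symm
      · exact Or.inr ⟨w, h1.symm, h2⟩
  set S' := S.map e.symm.toEmbedding with hS'
  have hcard' : #S' = 4 := by rw [hS', card_map, hcard]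
  have hne : S'.Nonempty := card_pos.1 (by omega)
  have hmem : ∀ i ∈ S', e i ∈ S := by
    intro i hi
    obtain ⟨u, hu, rfl⟩ := mem_map.1 hi
    simpa using hu
  refine ⟨S'.max' hne, ?_⟩
  have hsub : S'.erase (S'.max' hne) ⊆ lowerNeighbors ((graphSquare G).comap e) (S'.max' hne) := by
    intro i hi
    obtain ⟨h1, h2⟩ := mem_erase.1 hi
    exact mem_lowerNeighbors.2 ⟨(S'.le_max' i h2).lt_of_ne h1,
      hclique _ (hmem _ (S'.max'_mem hne)) _ (hmem i h2) (e.injective.ne h1.symm)⟩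
  have := card_le_card hsub
  rw [card_erase_of_mem (S'.max'_mem hne)] at this
  omega

/-- A connected graph without a vertex of degree three has a Hamiltonian path. -/
theorem exists_isPath_forall_mem_support {V : Type*} [Finite V] {G : SimpleGraph V}
    (hG : G.Connected)
    (hdeg : ∀ w a b c, G.Adj w a → G.Adj w b → G.Adj w c → a ≠ b → a ≠ c → b ≠ c → False) :
    ∃ (u v : V) (p : G.Walk u v), p.IsPath ∧ ∀ w, w ∈ p.support := by
  have := hG.nonempty
  have := Fintype.ofFinite V
  classical
  obtain ⟨u, v, p, hp, hmax⟩ := SimpleGraph.Walk.exists_isPath_forall_isPath_length_le_length G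
  refine ⟨u, v, p, hp, fun w => ?_⟩
  by_contra hw
  obtain ⟨q⟩ := hG.preconnected u w
  -- An edge leaving the longest path p extends it if it starts at an end of p, and otherwise
  -- creates a vertex with three neighbours.
  obtain ⟨d, -, hd1, hd2⟩ := q.exists_boundary_dart {x | x ∈ p.support} p.start_mem_support hw
  obtain ⟨i, hi, hil⟩ := SimpleGraph.Walk.mem_support_iff_exists_getVert.1 hd1
  have hd2 : d.snd ∉ p.support := hd2
  have hnot : ∀ k, p.getVert k ≠ d.snd := fun k h => hd2 (h ▸ p.getVert_mem_support k)
  have hadj : G.Adj d.fst d.snd := d.adj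
  rw [← hi] at hadj
  rcases Nat.eq_zero_or_pos i with rfl | hi0
  · rw [p.getVert_zero] at hadj
    have := hmax _ _ _ (hp.cons (h := hadj.symm) hd2)
    simp at this
  rcases hil.eq_or_lt with rfl | hlt
  · rw [p.getVert_length] at hadj
    have := hmax _ _ _ (hp.concat hd2 hadj)
    simp at this
  · have h1 : G.Adj (p.getVert (i - 1)) (p.getVert (i - 1 + 1)) := p.adj_getVert_succ (by omega)
    rw [Nat.sub_add_cancel hi0] at h1
    refine hdeg _ _ _ _ h1.symm (p.adj_getVert_succ hlt) hadj (fun h => ?_) (hnot _) (hnot _)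
    have := hp.getVert_injOn (show i - 1 ≤ p.length by omega) (show i + 1 ≤ p.length by omega) h
    omega

theorem nonempty_iso_pathGraph {V : Type*} [Fintype V] {n : ℕ} {G : SimpleGraph V}
    (hG : G.IsTree) (hcard : Fintype.card V = n)
    (hdeg : ∀ w a b c, G.Adj w a → G.Adj w b → G.Adj w c → a ≠ b → a ≠ c → b ≠ c → False) :
    Nonempty (G ≃g SimpleGraph.pathGraph n) := by
  obtain ⟨u, v, p, hp, hall⟩ := exists_isPath_forall_mem_support hG.connected hdeg
  have hbij : Function.Bijective fun i : Fin (p.length + 1) => p.getVert i := by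
    refine ⟨fun i j h => Fin.ext (hp.getVert_injOn ?_ ?_ h), fun w => ?_⟩
    · exact Nat.le_of_lt_succ i.2
    · exact Nat.le_of_lt_succ j.2
    · obtain ⟨i, hi, hil⟩ := SimpleGraph.Walk.mem_support_iff_exists_getVert.1 (hall w)
      exact ⟨⟨i, by omega⟩, hi⟩
  let f := Equiv.ofBijective _ hbij
  obtain rfl : p.length + 1 = n := by
    rw [← hcard, ← Fintype.card_congr f, Fintype.card_fin]
  let g := SimpleGraph.Iso.map f (SimpleGraph.pathGraph (p.length + 1))
  have hle : (SimpleGraph.pathGraph (p.length + 1)).map f.toEmbedding ≤ G := by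
    rw [SimpleGraph.map_le_iff_le_comap]
    intro i j hij
    rw [SimpleGraph.pathGraph_adj] at hij
    have hi := i.2
    have hj := j.2
    change G.Adj (p.getVert i) (p.getVert j)
    rcases hij with h | h
    · rw [← h]
      exact p.adj_getVert_succ (by omega)
    · rw [← h]
      exact (p.adj_getVert_succ (by omega)).symm
  -- The Hamiltonian path is a connected spanning subgraph, and a tree is minimal among connected
  -- graphs.
  have heq : (SimpleGraph.pathGraph (p.length + 1)).map f.toEmbedding = G :=
    le_antisymm hle ((SimpleGraph.isTree_iff_minimal_connected.1 hG).2
      (g.connected_iff.1 (SimpleGraph.pathGraph_connected _)) hle)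
  have hadj : ∀ a b, (SimpleGraph.pathGraph (p.length + 1)).Adj a b ↔ G.Adj (f a) (f b) :=
    fun a b => by simp only [← heq]; exact g.map_adj_iff.symm
  exact ⟨SimpleGraph.Iso.symm ⟨f, fun {a b} => (hadj a b).symm⟩⟩

theorem theorem3p4 {V : Type*} [Fintype V] (n : ℕ) (hn : 4 ≤ n)
    (T : SimpleGraph V) (hT : T.IsTree) (hcard : Fintype.card V = n) :
    graphSpectralRadius (graphSquare (SimpleGraph.pathGraph n)) ≤
        graphSpectralRadius (graphSquare T) ∧
      (graphSpectralRadius (graphSquare T) =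
          graphSpectralRadius (graphSquare (SimpleGraph.pathGraph n)) ↔
        Nonempty (T ≃g SimpleGraph.pathGraph n)) := by
  obtain ⟨e, he⟩ := exists_equiv_dominatesCenterOut (by omega) hT.connected hcard
  obtain ⟨hle, hlt⟩ := he.graphSpectralRadius_le (by omega)
  rw [graphSpectralRadius_congr (centerOutSquareIso n),
    graphSpectralRadius_congr (SimpleGraph.Iso.comap e (graphSquare T))] at hle hlt
  refine ⟨hle, fun heq => ?_, fun ⟨f⟩ => graphSpectralRadius_congr (graphSquareIso f)⟩
  refine nonempty_iso_pathGraph hT hcard fun w a b c ha hb hc hab hac hbc => ?_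
  exact (hlt (exists_two_lt_card_lowerNeighbors e ha hb hc hab hac hbc)).ne' heq
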